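/- Let $G$ be a finite $4$-edge-connected graph, possibly with loops and multiple edges (a loop at $v$ contributes $2$ to the degree $d_G(v)$; $4$-edge-connected means that $V(G)\neq\emptyset$ and for every nonempty proper subset $A\subsetneq V(G)$ at least $4$ edges of $G$ have exactly one end in $A$). Let $f: V(G)\to \mathbb{Z}_2$ be a mapping with $\sum_{v\in V(G)} f(v)\equiv 0 \pmod 2$. Then $G$ has a connected spanning subgraph $H$ such that for every vertex $v$, $$d_H(v)\equiv f(v) \pmod 2\quad\text{and}\quad \left\lfloor \frac{d_G(v)}{2}\right\rfloor-1\le d_H(v)\le \left\lceil \frac{d_G(v)}{2}\right\rceil+2.$$ In particular, $G$ has a spanning Eulerian subgraph $H$ (that is, a connected spanning subgraph all of whose degrees are even) such that for every vertex $v$, $$\left\lfloor \frac{d_G(v)}{2}\right\rfloor-1\le d_H(v)\le \left\lceil \frac{d_G(v)}{2}\right\rceil+2.$$ -/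

import Mathlib

namespace Graph

/-- The degree of `v` in a finite multigraph: the number of edges incident to `v`,
where every loop at `v` is counted twice. -/
noncomputable def degree {α β : Type*} (G : Graph α β) (v : α) : ℕ :=
  (G.incidenceSet v).ncard + (G.loopSet v).ncard

/-- The edges of `G` with exactly one end in the vertex set `A`. -/
def edgeCut {α β : Type*} (G : Graph α β) (A : Set α) : Set β :=
  {e | ∃ x y, G.IsLink e x y ∧ x ∈ A ∧ y ∉ A}

/-- `G` has a vertex, and any two vertices are joined by a walk. -/
def Connected {α β : Type*} (G : Graph α β) : Prop :=
  G.vertexSet.Nonempty ∧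
    ∀ x ∈ G.vertexSet, ∀ y ∈ G.vertexSet, Relation.ReflTransGen G.Adj x y

/-- `G` is `n`-edge-connected: it has a vertex, and every edge cut given by a nonempty proper
subset of the vertex set has at least `n` edges. -/
def IsEdgeConnected {α β : Type*} (G : Graph α β) (n : ℕ) : Prop :=
  G.vertexSet.Nonempty ∧
    ∀ A : Set α, A ⊂ G.vertexSet → A.Nonempty → (n : ℕ∞) ≤ (G.edgeCut A).encard

/-- `H` is an `f`-factor of `G` modulo `k`: a spanning subgraph whose degrees are congruent
to `f` modulo `k`. -/
def IsModFactor {α β : Type*} (G : Graph α β) {k : ℕ} (f : α → ZMod k) (H : Graph α β) : Prop :=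
  H ≤s G ∧ ∀ v ∈ G.vertexSet, (H.degree v : ZMod k) = f v

/-- A connected graph all of whose degrees are even. -/
def IsEulerian {α β : Type*} (G : Graph α β) : Prop :=
  G.Connected ∧ ∀ v ∈ G.vertexSet, Even (G.degree v)

end Graph

/-! The edges are divided into two edge-disjoint connected spanning subgraphs and a remainder
oriented so that every vertex has large in-degree. The first subgraph goes into `H` as a whole and
makes it connected; the freedom in the other edges is used to correct parities while staying within
the degree bounds.

The division (`exists_two_connected_and_orientation`) is a Rado-type choice of one of four roles for
each edge: member of the first or second subgraph, or oriented towards either end. The submodular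
function is the sum of two graphic ranks and of truncated in-degrees. Its Rado condition is a count
over the components of an edge set `J`: by 4-edge-connectivity, a component missing the root is left
by at least four edges outside `J`.

Orienting the second subgraph away from a root makes every vertex reachable from the root and
supplies one more in-arc at each other vertex. For such a digraph, `exists_signedDegree_mem_Icc`
selects arcs so that the degrees have prescribed parities and lie between given bounds, provided the
lower bound is at most the in-degree and the upper bound at least the out-degree. It is proved by
induction on the number of arcs, by directed splitting off or by deleting a sink; signs on the arcs
record how the choice is transported along a split path.

Reachability is arranged with an auxiliary arc entering the root from a new vertex. The handshake
lemma shows that this arc is never chosen, because `f` has even sum. -/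

/-- Independent-transversal theorem of Rado type for a monotone submodular function. -/
theorem exists_choice_of_submodular {ι κ : Type*} [Fintype ι] [DecidableEq ι] [Fintype κ]
    [DecidableEq κ] [Nonempty κ] (ρ : Finset (ι × κ) → ℕ) (hmono : Monotone ρ)
    (hsub : ∀ X Y, ρ (X ∪ Y) + ρ (X ∩ Y) ≤ ρ X + ρ Y) (t : ℕ)
    (h : ∀ J : Finset ι, t ≤ ρ (J ×ˢ Finset.univ) + Jᶜ.card) :
    ∃ g : ι → κ, t ≤ ρ (Finset.univ.image fun e => (e, g e)) := by
  classical
  set X : (ι → Finset κ) → Finset ι → Finset (ι × κ) :=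
    fun A J => Finset.univ.filter fun p => p.1 ∈ J ∧ p.2 ∈ A p.1 with hX
  -- Generalise to a list `A e` of allowed values for each `e`, so that the lists can be shrunk one
  -- value at a time until each is a singleton.
  suffices H : ∀ N : ℕ, ∀ A : ι → Finset κ, (∑ e, (A e).card) = N → (∀ e, (A e).Nonempty) →
      (∀ J, t ≤ ρ (X A J) + Jᶜ.card) →
      ∃ g : ι → κ, t ≤ ρ (Finset.univ.image fun e => (e, g e)) by
    refine H _ (fun _ => Finset.univ) rfl (fun _ => Finset.univ_nonempty) fun J => ?_
    refine (h J).trans (Nat.add_le_add_right (hmono ?_) _)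
    intro p hp
    simpa [hX] using hp
  intro N
  induction N using Nat.strong_induction_on with
  | _ N ih =>
  intro A hN hne hA
  by_cases hone : ∀ e, (A e).card ≤ 1
  · choose g hg using hne
    refine ⟨g, ?_⟩
    have := hA Finset.univ
    simp only [Finset.compl_univ, Finset.card_empty, add_zero] at this
    refine this.trans (hmono ?_)
    rintro ⟨e, k⟩ hp
    simp only [hX, Finset.mem_filter, Finset.mem_univ, true_and] at hp
    simp only [Finset.mem_image, Finset.mem_univ, true_and, Prod.mk.injEq]
    exact ⟨e, rfl, Finset.card_le_one.1 (hone e) _ (hg e) _ hp⟩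
  push Not at hone
  obtain ⟨e, he⟩ := hone
  obtain ⟨x, hx, y, hy, hxy⟩ := Finset.one_lt_card.1 he
  have key : ∀ x ∈ A e, (∀ J, t ≤ ρ (X (Function.update A e ((A e).erase x)) J) + Jᶜ.card) →
      ∃ g : ι → κ, t ≤ ρ (Finset.univ.image fun e => (e, g e)) := by
    intro x hx hJ
    refine ih (∑ e', (Function.update A e ((A e).erase x) e').card) ?_ _ rfl ?_ hJ
    · rw [← hN]
      refine Finset.sum_lt_sum (fun e' _ => ?_) ⟨e, Finset.mem_univ _, ?_⟩
      · by_cases h' : e' = e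
        · subst h'; simpa using Finset.card_erase_le
        · simp [h']
      · simpa using Finset.card_erase_lt_of_mem hx
    · intro e'
      by_cases h' : e' = e
      · subst h'
        rw [Function.update_self, ← Finset.card_pos, Finset.card_erase_of_mem hx]
        omega
      · simpa [h'] using hne e'
  by_contra hcon
  have k1 := mt (key x hx) hcon
  have k2 := mt (key y hy) hcon
  push Not at k1 k2
  obtain ⟨J, hJ⟩ := k1
  obtain ⟨K, hK⟩ := k2
  have mem : ∀ x, ∀ J : Finset ι, e ∉ J →
      X (Function.update A e ((A e).erase x)) J = X A J := by
    intro x J hJ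
    ext ⟨e', k⟩
    simp only [hX, Finset.mem_filter, Finset.mem_univ, true_and]
    refine and_congr_right fun h' => ?_
    have : e' ≠ e := by rintro rfl; exact hJ h'
    simp [this]
  have heJ : e ∈ J := by
    by_contra h'
    rw [mem x J h'] at hJ
    exact absurd (hA J) (by omega)
  have heK : e ∈ K := by
    by_contra h'
    rw [mem y K h'] at hK
    exact absurd (hA K) (by omega)
  -- If neither `x` nor `y` can be removed, the violating sets `J` and `K` both contain `e`.
  -- Uncrossing them into `J ∪ K` and `(J ∩ K).erase e` loses nothing: on `J ∪ K` each of `x`, `y`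
  -- survives in one of the two lists. Erasing `e` adds only one to the complements, while the two
  -- violations save two.
  have hU : X A (J ∪ K) ⊆ X (Function.update A e ((A e).erase x)) J ∪
      X (Function.update A e ((A e).erase y)) K := by
    rintro ⟨e', k⟩ hp
    simp only [hX, Finset.mem_filter, Finset.mem_univ, true_and, Finset.mem_union] at hp ⊢
    by_cases h' : e' = e
    · subst h'
      simp only [Function.update_self, Finset.mem_erase]
      by_cases hk : k = x
      · right; exact ⟨heK, fun h => hxy (hk ▸ h), hp.2⟩
      · left; exact ⟨heJ, hk, hp.2⟩
    · simp only [ne_eq, h', not_false_eq_true, Function.update_of_ne]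
      tauto
  have hI : X A ((J ∩ K).erase e) ⊆ X (Function.update A e ((A e).erase x)) J ∩
      X (Function.update A e ((A e).erase y)) K := by
    rintro ⟨e', k⟩ hp
    simp only [hX, Finset.mem_filter, Finset.mem_univ, true_and, Finset.mem_inter,
      Finset.mem_erase] at hp ⊢
    simp only [ne_eq, hp.1.1, not_false_eq_true, Function.update_of_ne]
    tauto
  have a1 := hmono hU
  have a2 := hmono hI
  have a3 := hsub (X (Function.update A e ((A e).erase x)) J)
    (X (Function.update A e ((A e).erase y)) K)
  have b1 := hA (J ∪ K)
  have b2 := hA ((J ∩ K).erase e)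
  have c1 := Finset.card_union_add_card_inter J K
  have c2 := Finset.card_erase_of_mem (Finset.mem_inter.2 ⟨heJ, heK⟩)
  have c3 : 0 < (J ∩ K).card := Finset.card_pos.2 ⟨e, Finset.mem_inter.2 ⟨heJ, heK⟩⟩
  have d0 := Finset.card_compl_add_card J
  have d1 := Finset.card_compl_add_card K
  have d2 := Finset.card_compl_add_card (J ∪ K)
  have d3 := Finset.card_compl_add_card ((J ∩ K).erase e)
  omega

/-! ### Graphic rank through incidence vectors -/

/-- The rank of a set of edges in the cycle matroid of the multigraph with ends `fst`, `snd`. -/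
noncomputable def edgeRank {V E : Type*} [Fintype V] [DecidableEq V] (fst snd : E → V)
    (F : Finset E) : ℕ :=
  Module.finrank ℚ (Submodule.span ℚ
    ((fun e => (Pi.single (fst e) 1 - Pi.single (snd e) 1 : V → ℚ)) '' (F : Set E)))

section edgeRank

variable {V E : Type*} [DecidableEq V] (fst snd : E → V)

theorem span_le_ker_sum (F : Finset E) (S : Finset V)
    (hS : ∀ e ∈ F, (fst e ∈ S ↔ snd e ∈ S)) :
    Submodule.span ℚ ((fun e => (Pi.single (fst e) 1 - Pi.single (snd e) 1 : V → ℚ)) ''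
      (F : Set E)) ≤ LinearMap.ker (∑ v ∈ S, LinearMap.proj (R := ℚ) (φ := fun _ : V => ℚ) v) := by
  rw [Submodule.span_le]
  rintro _ ⟨e, he, rfl⟩
  have := hS e he
  simp only [SetLike.mem_coe, LinearMap.mem_ker, LinearMap.sum_apply, LinearMap.proj_apply,
    Pi.sub_apply, Finset.sum_sub_distrib]
  by_cases h : fst e ∈ S <;> simp_all

variable [Fintype V]

theorem edgeRank_mono : Monotone (edgeRank fst snd) := fun F F' h =>
  Submodule.finrank_mono (Submodule.span_mono (Set.image_mono (by exact_mod_cast h)))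

theorem edgeRank_union_add_inter_le [DecidableEq E] (F F' : Finset E) :
    edgeRank fst snd (F ∪ F') + edgeRank fst snd (F ∩ F') ≤
      edgeRank fst snd F + edgeRank fst snd F' := by
  unfold edgeRank
  set b : E → V → ℚ := fun e => Pi.single (fst e) 1 - Pi.single (snd e) 1
  rw [← Submodule.finrank_sup_add_finrank_inf_eq (Submodule.span ℚ (b '' (F : Set E)))
    (Submodule.span ℚ (b '' (F' : Set E))), Finset.coe_union, Set.image_union,
    Submodule.span_union]
  refine Nat.add_le_add_left (Submodule.finrank_mono (le_inf ?_ ?_)) _ <;>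
  refine Submodule.span_mono (Set.image_mono ?_) <;> simp

theorem edgeRank_lt (F : Finset E) (r : V) : edgeRank fst snd F < Fintype.card V := by
  rw [← Module.finrank_fintype_fun_eq_card ℚ]
  refine Submodule.finrank_lt fun h => ?_
  have h1 := span_le_ker_sum fst snd F Finset.univ (by simp)
  rw [h] at h1
  have := h1 (show (Pi.single r 1 : V → ℚ) ∈ _ from trivial)
  simp at this

/-- If no edge of `F` crossed `S`, the incidence vectors would be killed by the sum over `S` as well
as by the sum over all vertices. These functionals are independent, so the rank would be at most
`card V - 2`. -/
theorem exists_crossing_of_edgeRank (F : Finset E) (hF : Fintype.card V ≤ edgeRank fst snd F + 1)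
    (S : Finset V) (hne : S.Nonempty) (hS : S ≠ Finset.univ) :
    ∃ e ∈ F, ¬ (fst e ∈ S ↔ snd e ∈ S) := by
  by_contra! hcon
  obtain ⟨a, ha⟩ := hne
  obtain ⟨b, hb⟩ : ∃ b, b ∉ S := by
    by_contra! h
    exact hS (Finset.eq_univ_iff_forall.2 h)
  have h1 := span_le_ker_sum fst snd F Finset.univ (by simp)
  have h2 := span_le_ker_sum fst snd F S hcon
  have k1 : LinearMap.ker (∑ v : V, LinearMap.proj (R := ℚ) (φ := fun _ : V => ℚ) v) < ⊤ := by
    refine lt_top_iff_ne_top.2 fun h => ?_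
    have := h ▸ (show (Pi.single a 1 : V → ℚ) ∈ (⊤ : Submodule ℚ (V → ℚ)) from trivial)
    simp at this
  have k2 := lt_of_le_of_ne h1 (fun h => by
    have h3 : (Pi.single a 1 - Pi.single b 1 : V → ℚ) ∈
        LinearMap.ker (∑ v : V, LinearMap.proj (R := ℚ) (φ := fun _ : V => ℚ) v) := by
      simp
    have := h2 (h ▸ h3)
    simp [ha, hb] at this)
  have l1 := Submodule.finrank_lt_finrank_of_lt k1
  have l2 := Submodule.finrank_lt_finrank_of_lt k2
  rw [finrank_top, Module.finrank_fintype_fun_eq_card] at l1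
  unfold edgeRank at hF
  omega

/-- Adding one unit vector per class to the span of the incidence vectors yields the whole space,
since every vertex is joined to its class representative by edges of `F`. -/
theorem card_le_edgeRank_add_card (F : Finset E) (s : Setoid V) [Fintype (Quotient s)]
    (hs : ∀ x y, s x y → Relation.EqvGen (fun x y => ∃ e ∈ F, fst e = x ∧ snd e = y) x y) :
    Fintype.card V ≤ edgeRank fst snd F + Fintype.card (Quotient s) := by
  classical
  set W := Submodule.span ℚ ((fun e => (Pi.single (fst e) 1 - Pi.single (snd e) 1 : V → ℚ)) ''
      (F : Set E)) with hW
  set W' := Submodule.span ℚ (Set.range fun q : Quotient s => (Pi.single q.out 1 : V → ℚ)) with hW'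
  have h1 : ∀ x y, Relation.EqvGen (fun x y => ∃ e ∈ F, fst e = x ∧ snd e = y) x y →
      (Pi.single x 1 - Pi.single y 1 : V → ℚ) ∈ W := by
    intro x y h
    induction h with
    | rel x y h =>
      obtain ⟨e, he, rfl, rfl⟩ := h
      exact Submodule.subset_span ⟨e, he, rfl⟩
    | refl x => simp
    | symm x y _ ih => simpa using W.neg_mem ih
    | trans x y z _ _ ih1 ih2 => simpa using W.add_mem ih1 ih2
  have h2 : W ⊔ W' = ⊤ := by
    refine eq_top_iff.2 ?_
    rw [← (Pi.basisFun ℚ V).span_eq, Submodule.span_le]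
    rintro _ ⟨v, rfl⟩
    have h3 := h1 v (⟦v⟧ : Quotient s).out (hs _ _ (s.symm (Quotient.mk_out v)))
    have h4 : (Pi.single (⟦v⟧ : Quotient s).out 1 : V → ℚ) ∈ W' :=
      Submodule.subset_span ⟨_, rfl⟩
    have := Submodule.add_mem_sup h3 h4
    simpa using this
  have h5 := Submodule.finrank_add_le_finrank_add_finrank W W'
  have h6 : Module.finrank ℚ W' ≤ Fintype.card (Quotient s) := finrank_range_le_card _
  rw [h2, finrank_top, Module.finrank_fintype_fun_eq_card] at h5
  change _ ≤ Module.finrank ℚ W + _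
  omega

end edgeRank

/-! ### Truncated counts and degrees -/

theorem min_card_filter_submodular {γ : Type*} [DecidableEq γ] (P : γ → Prop) [DecidablePred P]
    (c : ℕ) (X Y : Finset γ) :
    min c ((X ∪ Y).filter P).card + min c ((X ∩ Y).filter P).card ≤
      min c (X.filter P).card + min c (Y.filter P).card := by
  have h := Finset.card_union_add_card_inter (X.filter P) (Y.filter P)
  rw [← Finset.filter_union, ← Finset.filter_inter_distrib] at h
  have h1 : ((X ∩ Y).filter P).card ≤ (X.filter P).card :=
    Finset.card_le_card (Finset.filter_subset_filter _ Finset.inter_subset_left)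
  have h2 : ((X ∩ Y).filter P).card ≤ (Y.filter P).card :=
    Finset.card_le_card (Finset.filter_subset_filter _ Finset.inter_subset_right)
  omega

/-- The degree of `v` in the multigraph with edge set `F` and ends `fst`, `snd`. -/
def endDegree {V E : Type*} [DecidableEq V] (fst snd : E → V) (F : Finset E) (v : V) : ℕ :=
  (F.filter fun e => fst e = v).card + (F.filter fun e => snd e = v).card

section endDegree

variable {V E : Type*} [DecidableEq V] (fst snd : E → V)

theorem endDegree_add_compl [Fintype E] [DecidableEq E] (F : Finset E) (v : V) :
    endDegree fst snd F v + endDegree fst snd Fᶜ v = endDegree fst snd Finset.univ v := by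
  unfold endDegree
  have h : ∀ f : E → V, (F.filter fun e => f e = v).card + (Fᶜ.filter fun e => f e = v).card =
      (Finset.univ.filter fun e => f e = v).card := by
    intro f
    rw [← Finset.card_union_of_disjoint, ← Finset.filter_union, Finset.union_compl]
    exact Finset.disjoint_filter_filter disjoint_compl_right
  have := h fst
  have := h snd
  omega

theorem sum_endDegree_eq (F : Finset E) (S : Finset V) :
    ∑ v ∈ S, endDegree fst snd F v =
      (F.filter fun e => fst e ∈ S).card + (F.filter fun e => snd e ∈ S).card := by
  unfold endDegree
  rw [Finset.sum_add_distrib]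
  have h : ∀ f : E → V, ∑ v ∈ S, (F.filter fun e => f e = v).card =
      (F.filter fun e => f e ∈ S).card := by
    intro f
    rw [Finset.card_eq_sum_card_fiberwise (f := f) (t := S)]
    · refine Finset.sum_congr rfl fun v hv => ?_
      congr 1
      ext e
      simp only [Finset.mem_filter]
      constructor
      · rintro ⟨h, rfl⟩; exact ⟨⟨h, hv⟩, rfl⟩
      · rintro ⟨⟨h, _⟩, rfl⟩; exact ⟨h, rfl⟩
    · intro e he
      simpa using (Finset.mem_filter.1 he).2
  rw [h, h]

theorem card_crossing_le_sum_endDegree (F : Finset E) (S : Finset V) :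
    (F.filter fun e => ¬ (fst e ∈ S ↔ snd e ∈ S)).card ≤ ∑ v ∈ S, endDegree fst snd F v := by
  classical
  rw [sum_endDegree_eq]
  refine (Finset.card_le_card ?_).trans (Finset.card_union_le _ _)
  intro e he
  simp only [Finset.mem_filter, Finset.mem_union] at he ⊢
  tauto

theorem sum_endDegree_univ [Fintype V] (F : Finset E) :
    ∑ v, endDegree fst snd F v = 2 * F.card := by
  rw [sum_endDegree_eq]
  simp [two_mul]

end endDegree

/-! ### Two connected subgraphs and an orientation -/

section decomposition

variable {V E : Type*} [Fintype V] [DecidableEq V] [Fintype E] [DecidableEq E]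

/-- The classes play the role of components of `J`. A class other than that of `r` contributes at
least four: through a vertex of `Y` if it has one, and otherwise through its cut, all of whose edges
lie outside `J`. The final `+ 4` pays for the class of `r`. -/
theorem card_quotient_mul_four_le (fst snd : E → V) (r : V)
    (hcut : ∀ S : Finset V, S.Nonempty → S ≠ Finset.univ →
      4 ≤ (Finset.univ.filter fun e => ¬ (fst e ∈ S ↔ snd e ∈ S)).card)
    (J : Finset E) (Y : Finset V) (s : Setoid V) [Fintype (Quotient s)]
    (hs : ∀ e ∈ J, s (fst e) (snd e)) :
    4 * Fintype.card (Quotient s) + (if r ∈ Y then 4 else 0) ≤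
      ∑ v, (if v ∈ Y then 4 else endDegree fst snd Jᶜ v) + 4 := by
  classical
  rw [← Finset.sum_fiberwise Finset.univ (fun v => (⟦v⟧ : Quotient s)), mul_comm, ← Finset.card_univ,
    ← smul_eq_mul, ← Finset.sum_const, ← Finset.add_sum_erase _ _ (Finset.mem_univ (⟦r⟧ : Quotient s)),
    ← Finset.add_sum_erase _ _ (Finset.mem_univ (⟦r⟧ : Quotient s))]
  have h1 : (if r ∈ Y then 4 else 0) ≤ ∑ v with (⟦v⟧ : Quotient s) = ⟦r⟧,
      (if v ∈ Y then 4 else endDegree fst snd Jᶜ v) := by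
    refine le_trans ?_ (Finset.single_le_sum (fun _ _ => Nat.zero_le _)
      (Finset.mem_filter.2 ⟨Finset.mem_univ r, rfl⟩))
    split_ifs <;> simp
  have h2 : ∑ _q ∈ (Finset.univ : Finset (Quotient s)).erase ⟦r⟧, 4 ≤
      ∑ q ∈ (Finset.univ : Finset (Quotient s)).erase ⟦r⟧, ∑ v with (⟦v⟧ : Quotient s) = q,
      (if v ∈ Y then 4 else endDegree fst snd Jᶜ v) := by
    refine Finset.sum_le_sum fun q hq => ?_
    by_cases hY : ∃ v ∈ Y, (⟦v⟧ : Quotient s) = q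
    · obtain ⟨v, hv, hvq⟩ := hY
      refine le_trans ?_ (Finset.single_le_sum (fun _ _ => Nat.zero_le _)
        (Finset.mem_filter.2 ⟨Finset.mem_univ v, hvq⟩))
      simp [hv]
    · push Not at hY
      set S : Finset V := Finset.univ.filter fun v => (⟦v⟧ : Quotient s) = q with hS
      have h3 : ∑ v ∈ S, (if v ∈ Y then 4 else endDegree fst snd Jᶜ v) =
          ∑ v ∈ S, endDegree fst snd Jᶜ v := by
        refine Finset.sum_congr rfl fun v hv => if_neg fun h => hY v h ?_
        simpa [hS] using hv
      rw [h3]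
      refine (hcut S ?_ ?_).trans (le_trans (Finset.card_le_card ?_)
        (card_crossing_le_sum_endDegree fst snd Jᶜ S))
      · obtain ⟨v, hv⟩ := Quotient.exists_rep q
        exact ⟨v, by simpa [hS] using hv⟩
      · intro h
        have := h ▸ Finset.mem_univ r
        simp only [hS, Finset.mem_filter, Finset.mem_univ, true_and] at this
        exact (Finset.mem_erase.1 hq).1 this.symm
      · intro e he
        simp only [Finset.mem_filter, Finset.mem_univ, true_and, Finset.mem_compl] at he ⊢
        refine ⟨fun hJ => he ?_, he⟩
        simp only [hS, Finset.mem_filter, Finset.mem_univ, true_and]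
        rw [Quotient.sound (hs e hJ)]
  omega

/-- Every `4`-edge-connected multigraph contains two edge-disjoint connected spanning subgraphs such
that the remaining edges can be oriented with large in-degrees. -/
theorem exists_two_connected_and_orientation (fst snd : E → V) (r : V)
    (hcut : ∀ S : Finset V, S.Nonempty → S ≠ Finset.univ →
      4 ≤ (Finset.univ.filter fun e => ¬ (fst e ∈ S ↔ snd e ∈ S)).card) :
    ∃ g : E → Fin 4,
      (∀ S : Finset V, S.Nonempty → S ≠ Finset.univ → ∃ e, g e = 0 ∧ ¬ (fst e ∈ S ↔ snd e ∈ S)) ∧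
      (∀ S : Finset V, S.Nonempty → S ≠ Finset.univ → ∃ e, g e = 1 ∧ ¬ (fst e ∈ S ↔ snd e ∈ S)) ∧
      ∀ v, endDegree fst snd Finset.univ v / 2 ≤
        (Finset.univ.filter fun e => (g e = 2 ∧ fst e = v) ∨ (g e = 3 ∧ snd e = v)).card +
          if v = r then 1 else 2 := by
  classical
  set d := endDegree fst snd Finset.univ with hd
  -- Roles 0 and 1 put an edge into a connected subgraph; roles 2 and 3 orient it towards `fst` and
  -- `snd`. The cap at `r` may be larger by one because the component of `r` needs no cut of its own
  -- in the count.
  set cap : V → ℕ := fun v => d v / 2 - if v = r then 1 else 2 with hcap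
  set proj : Fin 4 → Finset (E × Fin 4) → Finset E :=
    fun i X => Finset.univ.filter fun e => (e, i) ∈ X with hproj
  set P : V → E × Fin 4 → Prop :=
    fun v p => (p.2 = 2 ∧ fst p.1 = v) ∨ (p.2 = 3 ∧ snd p.1 = v) with hP
  set ρ : Finset (E × Fin 4) → ℕ := fun X =>
    edgeRank fst snd (proj 0 X) + edgeRank fst snd (proj 1 X) +
      ∑ v, min (cap v) (X.filter (P v)).card with hρ
  have pmono : ∀ i, Monotone (proj i) := by
    intro i X Y h e he
    simp only [hproj, Finset.mem_filter, Finset.mem_univ, true_and] at he ⊢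
    exact h he
  have hmono : Monotone ρ := by
    intro X Y h
    refine add_le_add (add_le_add (edgeRank_mono _ _ (pmono 0 h)) (edgeRank_mono _ _ (pmono 1 h))) ?_
    exact Finset.sum_le_sum fun v _ =>
      min_le_min le_rfl (Finset.card_le_card (Finset.filter_subset_filter _ h))
  have hsub : ∀ X Y, ρ (X ∪ Y) + ρ (X ∩ Y) ≤ ρ X + ρ Y := by
    intro X Y
    have hu : ∀ i, proj i (X ∪ Y) = proj i X ∪ proj i Y := by
      intro i; ext e; simp [hproj]
    have hi : ∀ i, proj i (X ∩ Y) = proj i X ∩ proj i Y := by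
      intro i; ext e; simp [hproj]
    have h0 := edgeRank_union_add_inter_le fst snd (proj 0 X) (proj 0 Y)
    have h1 := edgeRank_union_add_inter_le fst snd (proj 1 X) (proj 1 Y)
    have h2 : ∑ v, min (cap v) ((X ∪ Y).filter (P v)).card +
        ∑ v, min (cap v) ((X ∩ Y).filter (P v)).card ≤
        ∑ v, min (cap v) (X.filter (P v)).card + ∑ v, min (cap v) (Y.filter (P v)).card := by
      rw [← Finset.sum_add_distrib, ← Finset.sum_add_distrib]
      exact Finset.sum_le_sum fun v _ => min_card_filter_submodular _ _ _ _
    simp only [hρ, hu, hi]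
    omega
  have hcond : ∀ J : Finset E,
      2 * (Fintype.card V - 1) + ∑ v, cap v ≤ ρ (J ×ˢ Finset.univ) + Jᶜ.card := by
    intro J
    set s : Setoid V := Relation.EqvGen.setoid fun x y => ∃ e ∈ J, fst e = x ∧ snd e = y with hs
    have : Fintype (Quotient s) := Fintype.ofFinite _
    have hrank := card_le_edgeRank_add_card fst snd J s fun x y h => h
    set Y : Finset V := Finset.univ.filter fun v => endDegree fst snd J v < cap v with hY
    have h4 := card_quotient_mul_four_le fst snd r hcut J Y s
      fun e he => Relation.EqvGen.rel _ _ ⟨e, he, rfl, rfl⟩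
    have hp : ∀ i, proj i (J ×ˢ Finset.univ) = J := by
      intro i; ext e; simp [hproj]
    have hdeg : ∀ v, ((J ×ˢ Finset.univ).filter (P v)).card = endDegree fst snd J v := by
      intro v
      have : (J ×ˢ Finset.univ).filter (P v) =
          (J.filter fun e => fst e = v).image (fun e => (e, (2 : Fin 4))) ∪
          (J.filter fun e => snd e = v).image (fun e => (e, (3 : Fin 4))) := by
        ext ⟨e, i⟩
        simp only [hP, Finset.mem_filter, Finset.mem_product, Finset.mem_univ, and_true,
          Finset.mem_union, Finset.mem_image, Prod.mk.injEq]
        constructor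
        · rintro ⟨h1, ⟨rfl, h2⟩ | ⟨rfl, h2⟩⟩
          · exact Or.inl ⟨e, ⟨h1, h2⟩, rfl, rfl⟩
          · exact Or.inr ⟨e, ⟨h1, h2⟩, rfl, rfl⟩
        · rintro (⟨e, ⟨h1, h2⟩, rfl, rfl⟩ | ⟨e, ⟨h1, h2⟩, rfl, rfl⟩)
          · exact ⟨h1, Or.inl ⟨rfl, h2⟩⟩
          · exact ⟨h1, Or.inr ⟨rfl, h2⟩⟩
      rw [this, Finset.card_union_of_disjoint, Finset.card_image_of_injective,
        Finset.card_image_of_injective, endDegree]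
      · intro a b h; simpa using h
      · intro a b h; simpa using h
      · rw [Finset.disjoint_left]
        rintro ⟨e, i⟩ h1 h2
        simp only [Finset.mem_image, Prod.mk.injEq] at h1 h2
        obtain ⟨_, _, _, rfl⟩ := h1
        obtain ⟨_, _, _, h⟩ := h2
        exact absurd h (by decide)
    -- Proved vertex by vertex. On `Y` the minimum is the degree in `J`, and `2 * cap v + 4` is at
    -- most the full degree, up to an excess of 2 at `r`; off `Y` the minimum is `cap v`.
    have hsum : ∑ v, 2 * cap v + ∑ v, (if v ∈ Y then 4 else endDegree fst snd Jᶜ v) ≤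
        ∑ v, 2 * min (cap v) (endDegree fst snd J v) + 2 * Jᶜ.card + if r ∈ Y then 2 else 0 := by
      have hr : (if r ∈ Y then 2 else 0) =
          ∑ v, if v = r then (if v ∈ Y then 2 else 0) else 0 := by simp
      rw [← sum_endDegree_univ fst snd Jᶜ, hr, ← Finset.sum_add_distrib,
        ← Finset.sum_add_distrib, ← Finset.sum_add_distrib]
      refine Finset.sum_le_sum fun v _ => ?_
      have hv : v ∈ Y ↔ endDegree fst snd J v < d v / 2 - if v = r then 1 else 2 := by
        simp [hY, hcap]
      have hv' := endDegree_add_compl fst snd J v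
      simp only [hv, hcap]
      change _ = d v at hv'
      split_ifs <;> omega
    have hn : 0 < Fintype.card V := Fintype.card_pos_iff.2 ⟨r⟩
    simp only [hρ, hp, hdeg]
    rw [← Finset.mul_sum, ← Finset.mul_sum] at hsum
    split_ifs at h4 hsum <;> omega
  obtain ⟨g, hg⟩ := exists_choice_of_submodular ρ hmono hsub _ hcond
  set X := Finset.univ.image fun e => (e, g e) with hX
  -- Each summand of `ρ X` is at most its share of the target, so reaching the target forces
  -- equality in every one.
  have r0 := edgeRank_lt fst snd (proj 0 X) r
  have r1 := edgeRank_lt fst snd (proj 1 X) r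
  have hle : ∀ v ∈ Finset.univ, min (cap v) (X.filter (P v)).card ≤ cap v :=
    fun v _ => min_le_left _ _
  have hle' := Finset.sum_le_sum hle
  simp only [hρ] at hg
  have hmem : ∀ i e, e ∈ proj i X → g e = i := by
    intro i e he
    simp only [hproj, hX, Finset.mem_filter, Finset.mem_univ, true_and, Finset.mem_image,
      Prod.mk.injEq] at he
    obtain ⟨_, rfl, h⟩ := he
    exact h
  refine ⟨g, fun S h1 h2 => ?_, fun S h1 h2 => ?_, fun v => ?_⟩
  · obtain ⟨e, he, h⟩ := exists_crossing_of_edgeRank fst snd (proj 0 X) (by omega) S h1 h2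
    exact ⟨e, hmem _ _ he, h⟩
  · obtain ⟨e, he, h⟩ := exists_crossing_of_edgeRank fst snd (proj 1 X) (by omega) S h1 h2
    exact ⟨e, hmem _ _ he, h⟩
  · have h1 := (Finset.sum_eq_sum_iff_of_le hle).1 (by omega) v (Finset.mem_univ v)
    have h2 : (X.filter (P v)).card ≤
        (Finset.univ.filter fun e => (g e = 2 ∧ fst e = v) ∨ (g e = 3 ∧ snd e = v)).card := by
      refine Finset.card_le_card_of_injOn Prod.fst ?_ ?_
      · rintro ⟨e, i⟩ h
        simp only [hX, hP, Finset.coe_filter, Finset.mem_image, Finset.mem_univ, true_and,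
          Prod.mk.injEq, Set.mem_ofPred_eq] at h ⊢
        obtain ⟨⟨_, rfl, rfl⟩, h⟩ := h
        exact h
      · rintro ⟨e, i⟩ h ⟨e', i'⟩ h' (rfl : e = e')
        simp only [hX, Finset.coe_filter, Finset.mem_image, Finset.mem_univ, true_and,
          Prod.mk.injEq, Set.mem_ofPred_eq] at h h'
        obtain ⟨⟨_, rfl, rfl⟩, _⟩ := h
        obtain ⟨⟨_, rfl, rfl⟩, _⟩ := h'
        rfl
    have h3 : cap v ≤ (X.filter (P v)).card := by omega
    simp only [hcap] at h3
    omega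

end decomposition

/-! ### Directed splitting off -/

section splitting

variable {V β : Type*} [DecidableEq V]

/-- The degree of `v` in the set of arcs of `A` chosen by `z`, where the choice of an arc `a` is
read off at its head, and is negated at its tail if `s a` holds. -/
def signedDegree (A : Finset β) (hd tl : β → V) (s z : β → Bool) (v : V) : ℕ :=
  ∑ a ∈ A, ((if hd a = v then (z a).toNat else 0) + if tl a = v then (z a ^^ s a).toNat else 0)

theorem signedDegree_congr {A : Finset β} {hd tl : β → V} {s z s' z' : β → Bool} {tl' : β → V}
    (h : ∀ a ∈ A, tl a = tl' a ∧ s a = s' a ∧ z a = z' a) (v : V) :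
    signedDegree A hd tl s z v = signedDegree A hd tl' s' z' v :=
  Finset.sum_congr rfl fun a ha => by obtain ⟨h1, h2, h3⟩ := h a ha; rw [h1, h2, h3]

variable [DecidableEq β]

theorem signedDegree_eq_add_erase {A : Finset β} {a : β} (ha : a ∈ A) (hd tl : β → V)
    (s z : β → Bool) (v : V) :
    signedDegree A hd tl s z v =
      ((if hd a = v then (z a).toNat else 0) + if tl a = v then (z a ^^ s a).toNat else 0) +
        signedDegree (A.erase a) hd tl s z v :=
  (Finset.add_sum_erase _ _ ha).symm

theorem card_filter_eq_add_erase {A : Finset β} {a : β} (ha : a ∈ A) (f : β → V) (v : V) :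
    (A.filter fun c => f c = v).card =
      (if f a = v then 1 else 0) + ((A.erase a).filter fun c => f c = v).card := by
  rw [Finset.card_filter, Finset.card_filter]
  exact (Finset.add_sum_erase _ (fun c => if f c = v then 1 else 0) ha).symm

/-- Directed splitting off: if every nonempty subset of `U` is entered by an arc, then at a vertex of
in-degree at least two and out-degree at least one some arc `b` into `v` and some arc `a` out of `v`
can be replaced by a single arc from the tail of `b` to the head of `a`. -/
theorem exists_splitting_pair (A : Finset β) (U : Finset V) (hd tl : β → V)
    (hcut : ∀ S ⊆ U, S.Nonempty → ∃ c ∈ A, hd c ∈ S ∧ tl c ∉ S) (v : V) (hv : v ∈ U)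
    (hin : 1 < (A.filter fun c => hd c = v).card) (hout : ∃ a ∈ A, tl a = v) :
    ∃ a ∈ A, ∃ b ∈ A, a ≠ b ∧ tl a = v ∧ hd b = v ∧ ∀ S ⊆ U, S.Nonempty →
      (∃ c ∈ A, c ≠ a ∧ c ≠ b ∧ hd c ∈ S ∧ tl c ∉ S) ∨ (hd a ∈ S ∧ tl b ∉ S) := by
  by_cases hloop : ∃ a ∈ A, tl a = v ∧ hd a = v
  · obtain ⟨a, ha, hat, hah⟩ := hloop
    obtain ⟨b, hb, hbh, hbt⟩ := hcut {v} (by simpa using hv) (by simp)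
    rw [Finset.mem_singleton] at hbh hbt
    refine ⟨a, ha, b, hb, ?_, hat, hbh, fun S hS hne => ?_⟩
    · rintro rfl; exact hbt hat
    obtain ⟨c, hc, h1, h2⟩ := hcut S hS hne
    by_cases hca : c = a
    · subst hca; rw [hat] at h2; rw [hah] at h1; exact absurd h1 h2
    by_cases hcb : c = b
    · subst hcb; right; rw [hah, ← hbh]; exact ⟨h1, h2⟩
    · exact Or.inl ⟨c, hc, hca, hcb, h1, h2⟩
  push Not at hloop
  obtain ⟨a, ha, hat⟩ := hout
  by_contra hcon
  push Not at hcon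
  -- With `a` fixed, each in-arc `b` that cannot be paired with it has an obstruction: a set
  -- avoiding `v` and entered only by `a`, or a set containing `v` and entered only by `b`.
  have hbad : ∀ b ∈ A, hd b = v →
      (∃ S ⊆ U, hd a ∈ S ∧ v ∉ S ∧ tl b ∈ S ∧ ∀ c ∈ A, hd c ∈ S → tl c ∉ S → c = a) ∨
      (∃ S ⊆ U, v ∈ S ∧ tl b ∉ S ∧ hd a ∉ S ∧ ∀ c ∈ A, hd c ∈ S → tl c ∉ S → c = b) := by
    intro b hb hbv
    have hab : a ≠ b := by rintro rfl; exact hloop a ha hat hbv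
    obtain ⟨S, hS, hne, h1, h2⟩ := hcon a ha b hb hab hat hbv
    by_cases hvS : v ∈ S
    · have haS : ∀ c ∈ A, hd c ∈ S → tl c ∉ S → c = b := by
        intro c hc h3 h4
        by_contra hcb
        exact h4 (h1 c hc (by rintro rfl; exact h4 (hat ▸ hvS)) hcb h3)
      obtain ⟨c, hc, h3, h4⟩ := hcut S hS hne
      obtain rfl := haS c hc h3 h4
      exact Or.inr ⟨S, hS, hvS, h4, fun h => h4 (h2 h), haS⟩
    · have haS : ∀ c ∈ A, hd c ∈ S → tl c ∉ S → c = a := by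
        intro c hc h3 h4
        by_contra hca
        exact h4 (h1 c hc hca (by rintro rfl; exact hvS (hbv ▸ h3)) h3)
      obtain ⟨c, hc, h3, h4⟩ := hcut S hS hne
      obtain rfl := haS c hc h3 h4
      exact Or.inl ⟨S, hS, h3, hvS, h2 h3, haS⟩
  -- If all obstructions were of the first kind, their union together with `v` would be entered by
  -- no arc.
  obtain ⟨t, ht, htv, ht2⟩ : ∃ t ∈ A, hd t = v ∧ ¬ (∃ S ⊆ U, hd a ∈ S ∧ v ∉ S ∧ tl t ∈ S ∧
      ∀ c ∈ A, hd c ∈ S → tl c ∉ S → c = a) := by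
    by_contra! hall
    choose! T hT using hall
    obtain ⟨c, hc, h1, h2⟩ := hcut (insert v ((A.filter fun c => hd c = v).biUnion T)) (by
      intro x hx
      rw [Finset.mem_insert, Finset.mem_biUnion] at hx
      obtain rfl | ⟨b, hb, hx⟩ := hx
      · exact hv
      · rw [Finset.mem_filter] at hb
        exact (hT b hb.1 hb.2).1 hx) ⟨v, by simp⟩
    simp only [Finset.mem_insert, Finset.mem_biUnion, Finset.mem_filter, not_or, not_exists,
      not_and] at h1 h2
    obtain h1 | ⟨b, ⟨hb, hbv⟩, h1⟩ := h1
    · exact h2.2 c ⟨hc, h1⟩ (hT c hc h1).2.2.2.1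
    · obtain rfl := (hT b hb hbv).2.2.2.2 c hc h1 (h2.2 b ⟨hb, hbv⟩)
      exact h2.1 hat
  obtain ⟨S, hS, hvS, htS, haS, hSt⟩ := (hbad t ht htv).resolve_left ht2
  obtain ⟨b, hb, hbt⟩ := Finset.exists_mem_ne hin t
  rw [Finset.mem_filter] at hb
  obtain ⟨hbA, hbv⟩ := hb
  -- Uncross the obstruction of `t` with that of a second in-arc `b`: the intersection if the latter
  -- avoids `v`, the union otherwise, is entered by no arc.
  rcases hbad b hbA hbv with ⟨T, hT, haT, hvT, hbT, hTa⟩ | ⟨T, hT, hvT, hbT, haT, hTb⟩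
  · have hbS : tl b ∈ S := by
      by_contra h
      exact hbt (hSt b hbA (hbv ▸ hvS) h)
    obtain ⟨c, hc, h1, h2⟩ := hcut (S ∩ T) (Finset.inter_subset_left.trans hS)
      ⟨tl b, Finset.mem_inter.2 ⟨hbS, hbT⟩⟩
    simp only [Finset.mem_inter, not_and] at h1 h2
    by_cases h3 : tl c ∈ S
    · obtain rfl := hTa c hc h1.2 (h2 h3)
      exact haS h1.1
    · obtain rfl := hSt c hc h1.1 h3
      exact hvT (htv ▸ h1.2)
  · obtain ⟨c, hc, h1, h2⟩ := hcut (S ∪ T) (Finset.union_subset hS hT)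
      ⟨v, Finset.mem_union_left _ hvS⟩
    simp only [Finset.mem_union, not_or] at h1 h2
    rcases h1 with h1 | h1
    · obtain rfl := hSt c hc h1 h2.1
      exact hbt (hTb c hc (htv ▸ hvT) h2.2).symm
    · obtain rfl := hTb c hc h1 h2.2
      exact hbt (hSt c hc (hbv ▸ hvS) h2.1)

/-- The choice at `b` is set so that `a` and `b` together contribute exactly one at `v`. What `b`
then contributes at its tail is `z a` twisted by the new sign, so the merged arc, which keeps the
name `a`, behaves as one signed arc. -/
theorem signedDegree_split {A : Finset β} {a b : β} (ha : a ∈ A) (hb : b ∈ A) (hab : a ≠ b)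
    (hd tl : β → V) (s z : β → Bool) (v : V) (hat : tl a = v) (hbv : hd b = v) (w : V) :
    signedDegree A hd tl s (Function.update z b (!(z a ^^ s a))) w =
      signedDegree (A.erase b) hd (Function.update tl a (tl b))
        (Function.update s a (!(s a ^^ s b))) z w + if w = v then 1 else 0 := by
  have ha' : a ∈ A.erase b := Finset.mem_erase.2 ⟨hab, ha⟩
  rw [signedDegree_eq_add_erase hb, signedDegree_eq_add_erase ha', signedDegree_eq_add_erase ha']
  have hcongr : signedDegree ((A.erase b).erase a) hd tl s (Function.update z b (!(z a ^^ s a))) w =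
      signedDegree ((A.erase b).erase a) hd (Function.update tl a (tl b))
        (Function.update s a (!(s a ^^ s b))) z w := by
    refine signedDegree_congr (fun c hc => ?_) w
    simp only [Finset.mem_erase] at hc
    simp [hc.1, hc.2.1]
  rw [hcongr]
  subst hat
  simp only [Function.update_self, Function.update_of_ne hab, hbv, eq_comm (a := w)]
  generalize z a = x
  generalize s a = p
  generalize s b = q
  split_ifs <;> cases x <;> cases p <;> cases q <;> simp <;> omega

end splitting

section splitting

variable {V β : Type*} [DecidableEq V]

/-- Otherwise every vertex of `U` has in-degree at most one and out-degree at least one. As all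
heads lie in `U`, there are then at least as many arcs with tail in `U` as arcs in total,
contradicting an arc that enters `U`. -/
theorem exists_sink_or_splittable (A : Finset β) (U : Finset V) (hd tl : β → V)
    (hhd : ∀ a ∈ A, hd a ∈ U)
    (hcut : ∀ S ⊆ U, S.Nonempty → ∃ c ∈ A, hd c ∈ S ∧ tl c ∉ S) (hU : U.Nonempty) :
    ∃ v ∈ U, (∀ a ∈ A, tl a ≠ v) ∨
      (1 < (A.filter fun c => hd c = v).card ∧ ∃ a ∈ A, tl a = v) := by
  by_contra! hcon
  have h1 : ∀ v ∈ U, (A.filter fun c => hd c = v).card ≤ 1 := by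
    intro v hv
    by_contra! h
    obtain ⟨a, ha, hav⟩ := (hcon v hv).1
    exact (hcon v hv).2 h a ha hav
  have h2 : ∀ v ∈ U, 1 ≤ (A.filter fun c => tl c = v).card := by
    intro v hv
    obtain ⟨a, ha, hav⟩ := (hcon v hv).1
    exact Finset.card_pos.2 ⟨a, Finset.mem_filter.2 ⟨ha, hav⟩⟩
  obtain ⟨c, hc, -, hcU⟩ := hcut U subset_rfl hU
  have h3 : A.card = ∑ v ∈ U, (A.filter fun c => hd c = v).card :=
    Finset.card_eq_sum_card_fiberwise hhd
  have h4 : (A.filter fun c => tl c ∈ U).card = ∑ v ∈ U, (A.filter fun c => tl c = v).card := by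
    rw [Finset.card_eq_sum_card_fiberwise (f := tl) (t := U) fun a ha => by
      simpa using (Finset.mem_filter.1 ha).2]
    refine Finset.sum_congr rfl fun v hv => ?_
    rw [Finset.filter_filter]
    congr 1
    ext a
    simp only [Finset.mem_filter]
    exact and_congr_right fun _ => ⟨fun h => h.2, fun h => ⟨h ▸ hv, h⟩⟩
  have h5 : (A.filter fun c => tl c ∈ U).card < A.card :=
    Finset.card_lt_card (Finset.filter_ssubset.2 ⟨c, hc, hcU⟩)
  have h6 := Finset.sum_le_sum h1
  have h7 := Finset.sum_le_sum h2
  omega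

variable [DecidableEq β]

/-- In a digraph whose vertices in `U` are all reachable from outside `U`, arcs can be chosen such
that the (signed) degrees in `U` have prescribed parities and bounds. -/
theorem exists_signedDegree_mem_Icc (s : β → Bool) (A : Finset β) (U : Finset V) (hd tl : β → V)
    (hhd : ∀ a ∈ A, hd a ∈ U)
    (hcut : ∀ S ⊆ U, S.Nonempty → ∃ c ∈ A, hd c ∈ S ∧ tl c ∉ S) (l u : V → ℤ)
    (hlu : ∀ v ∈ U, l v ≤ u v ∧ Even (u v - l v))
    (hl : ∀ v ∈ U, l v ≤ (A.filter fun c => hd c = v).card)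
    (hu : ∀ v ∈ U, ((A.filter fun c => tl c = v).card : ℤ) ≤ u v) :
    ∃ z : β → Bool, ∀ v ∈ U, l v ≤ signedDegree A hd tl s z v ∧ signedDegree A hd tl s z v ≤ u v ∧
      Even ((signedDegree A hd tl s z v : ℤ) - l v) := by
  induction hN : A.card using Nat.strong_induction_on generalizing A U tl s l u with
  | _ N ih =>
  subst hN
  obtain rfl | hU := U.eq_empty_or_nonempty
  · exact ⟨fun _ => false, by simp⟩
  obtain ⟨v, hv, hsink | ⟨hin, hout⟩⟩ := exists_sink_or_splittable A U hd tl hhd hcut hU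
  · set B := A.filter fun c => hd c = v with hB
    set A' := A.filter fun c => hd c ≠ v with hA'
    obtain ⟨c₀, hc₀, hc₀v, -⟩ := hcut {v} (by simpa using hv) (by simp)
    rw [Finset.mem_singleton] at hc₀v
    have hBpos : 0 < B.card := Finset.card_pos.2 ⟨c₀, Finset.mem_filter.2 ⟨hc₀, hc₀v⟩⟩
    -- At a sink the degree is just the number of chosen in-arcs: take `l v`, or its parity if it is
    -- negative. The value 1 is available because `v` has an in-arc, and `u v`, being odd and
    -- nonnegative, is at least 1.
    obtain ⟨n, hn, hln, hnu, hnl⟩ : ∃ n : ℕ, n ≤ B.card ∧ l v ≤ n ∧ n ≤ u v ∧ Even (n - l v) := by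
      have h1 := hlu v hv
      have h2 : l v ≤ B.card := hl v hv
      have h3 := hu v hv
      rw [Finset.filter_eq_empty_iff.2 fun a ha => hsink a ha, Finset.card_empty] at h3
      by_cases h0 : 0 ≤ l v
      · exact ⟨(l v).toNat, by omega, by omega, by omega, by rw [Int.toNat_of_nonneg h0]; simp⟩
      · rcases Int.even_or_odd (l v) with he | ho
        · exact ⟨0, by omega, by omega, by omega, by simpa using he⟩
        · refine ⟨1, by omega, by omega, ?_, ?_⟩
          · have : Odd (u v) := by
              have := h1.2.add_odd ho
              simpa using this
            obtain ⟨k, hk⟩ := this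
            push_cast
            omega
          · push_cast
            exact odd_one.sub_odd ho
    obtain ⟨C, hCB, hC⟩ := Finset.exists_subset_card_eq hn
    -- The contribution of the decided arcs at their tails; it is subtracted from both bounds before
    -- `v` is deleted. The upper bound stays valid because the out-degree falls by at least as much.
    set k : V → ℕ := fun x => ∑ a ∈ B, if tl a = x then (decide (a ∈ C) ^^ s a).toNat else 0 with hk
    have hkle : ∀ x, k x ≤ (B.filter fun c => tl c = x).card := by
      intro x
      rw [hk, Finset.card_filter]
      refine Finset.sum_le_sum fun a _ => ?_
      split_ifs
      · exact Bool.toNat_le _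
      · exact le_rfl
    have htl : ∀ x, (A.filter fun c => tl c = x).card =
        (B.filter fun c => tl c = x).card + (A'.filter fun c => tl c = x).card := by
      intro x
      simp only [Finset.card_filter]
      exact (Finset.sum_filter_add_sum_filter_not A (fun c => hd c = v) _).symm
    have hdeg : ∀ x ≠ v, (A'.filter fun c => hd c = x) = A.filter fun c => hd c = x := by
      intro x hx
      rw [hA', Finset.filter_filter]
      refine Finset.filter_congr fun c _ => ⟨fun h => h.2, fun h => ⟨h ▸ hx, h⟩⟩
    obtain ⟨z, hz⟩ := ih A'.card
      (Finset.card_lt_card (Finset.filter_ssubset.2 ⟨c₀, hc₀, by simpa using hc₀v⟩))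
      s A' (U.erase v) tl
      (fun a ha => by
        rw [Finset.mem_filter] at ha
        exact Finset.mem_erase.2 ⟨ha.2, hhd a ha.1⟩)
      (fun S hS hne => by
        obtain ⟨c, hc, h1, h2⟩ := hcut S (hS.trans (Finset.erase_subset _ _)) hne
        exact ⟨c, Finset.mem_filter.2 ⟨hc, (Finset.mem_erase.1 (hS h1)).1⟩, h1, h2⟩)
      (fun x => l x - k x) (fun x => u x - k x)
      (fun x hx => by
        have := hlu x (Finset.mem_of_mem_erase hx)
        refine ⟨by omega, by simpa using this.2⟩)
      (fun x hx => by
        rw [hdeg x (Finset.ne_of_mem_erase hx)]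
        have := hl x (Finset.mem_of_mem_erase hx)
        omega)
      (fun x hx => by
        have h1 := hu x (Finset.mem_of_mem_erase hx)
        have h2 := htl x
        have h3 := hkle x
        omega) rfl
    refine ⟨fun a => if hd a = v then decide (a ∈ C) else z a, fun x hx => ?_⟩
    have hsplit : ∀ x, signedDegree A hd tl s (fun a => if hd a = v then decide (a ∈ C) else z a) x =
        (if v = x then n else 0) + k x + signedDegree A' hd tl s z x := by
      intro x
      rw [signedDegree, ← Finset.sum_filter_add_sum_filter_not A (fun c => hd c = v)]
      congr 1
      · rw [Finset.sum_add_distrib]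
        congr 1
        · by_cases hvx : v = x
          · subst hvx
            rw [if_pos rfl, ← hC, ← Finset.inter_eq_right.2 hCB, ← Finset.filter_mem_eq_inter,
              Finset.card_filter]
            refine Finset.sum_congr rfl fun a ha => ?_
            have := (Finset.mem_filter.1 ha).2
            simp only [this, if_true]
            by_cases h : a ∈ C <;> simp [h, ha]
          · rw [if_neg hvx]
            refine Finset.sum_eq_zero fun a ha => if_neg ?_
            rw [(Finset.mem_filter.1 ha).2]
            exact hvx
        · refine Finset.sum_congr rfl fun a ha => ?_
          rw [if_pos (Finset.mem_filter.1 ha).2]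
      · refine Finset.sum_congr rfl fun a ha => ?_
        rw [if_neg (Finset.mem_filter.1 ha).2]
    rw [hsplit]
    by_cases hxv : x = v
    · subst hxv
      have h1 : k x = 0 := Finset.sum_eq_zero fun a ha =>
        if_neg (hsink a (Finset.mem_of_mem_filter a ha))
      have h2 : signedDegree A' hd tl s z x = 0 := by
        refine Finset.sum_eq_zero fun a ha => ?_
        rw [Finset.mem_filter] at ha
        rw [if_neg ha.2, if_neg (hsink a ha.1), add_zero]
      rw [h1, h2]
      simpa using ⟨hln, hnu, hnl⟩
    · obtain ⟨h1, h2, h3⟩ := hz x (Finset.mem_erase.2 ⟨hxv, hx⟩)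
      rw [if_neg (Ne.symm hxv)]
      push_cast
      refine ⟨by omega, by omega, ?_⟩
      convert h3 using 1
      ring
  · obtain ⟨a, ha, b, hb, hab, hat, hbv, hsplit⟩ :=
      exists_splitting_pair A U hd tl hcut v hv hin hout
    have ha' : a ∈ A.erase b := Finset.mem_erase.2 ⟨hab, ha⟩
    -- Splitting lowers both the in-degree and the out-degree of `v` by one, which matches the
    -- lowering of both bounds there.
    obtain ⟨z, hz⟩ := ih (A.erase b).card (Finset.card_erase_lt_of_mem hb)
      (Function.update s a (!(s a ^^ s b))) (A.erase b) U (Function.update tl a (tl b))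
      (fun c hc => hhd c (Finset.mem_of_mem_erase hc))
      (fun S hS hne => by
        obtain ⟨c, hc, hca, hcb, h1, h2⟩ | ⟨h1, h2⟩ := hsplit S hS hne
        · exact ⟨c, Finset.mem_erase.2 ⟨hcb, hc⟩, h1, by simpa [hca] using h2⟩
        · exact ⟨a, ha', h1, by simpa using h2⟩)
      (fun x => l x - if x = v then 1 else 0) (fun x => u x - if x = v then 1 else 0)
      (fun x hx => by
        have := hlu x hx
        exact ⟨by omega, by simpa using this.2⟩)
      (fun x hx => by
        have h1 := hl x hx
        rw [card_filter_eq_add_erase hb, hbv] at h1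
        simp only [eq_comm (a := x)]
        push_cast at h1
        omega)
      (fun x hx => by
        have h1 := hu x hx
        rw [card_filter_eq_add_erase hb, card_filter_eq_add_erase ha', hat] at h1
        rw [card_filter_eq_add_erase ha', Function.update_self]
        have h2 : (((A.erase b).erase a).filter fun c => Function.update tl a (tl b) c = x) =
            ((A.erase b).erase a).filter fun c => tl c = x := by
          refine Finset.filter_congr fun c hc => ?_
          rw [Function.update_of_ne (Finset.ne_of_mem_erase hc)]
        rw [h2]
        simp only [eq_comm (a := x)]
        push_cast at h1 ⊢
        omega) rfl
    refine ⟨Function.update z b (!(z a ^^ s a)), fun x hx => ?_⟩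
    obtain ⟨h1, h2, h3⟩ := hz x hx
    rw [signedDegree_split ha hb hab hd tl s z v hat hbv]
    push_cast
    refine ⟨by omega, by omega, ?_⟩
    convert h3 using 1
    ring

end splitting

/-! ### Parity correction -/

section parity

variable {V E : Type*} [Fintype V] [DecidableEq V]

/-- This encodes a spanning tree rooted at `r`: a largest vertex set admitting such levels cannot be
proper, since a crossing edge would attach a new vertex one level higher. -/
theorem exists_level_of_crossing (fst snd : E → V) (r : V) (p : E → Prop)
    (h : ∀ S : Finset V, S.Nonempty → S ≠ Finset.univ → ∃ e, p e ∧ ¬ (fst e ∈ S ↔ snd e ∈ S)) :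
    ∃ lev : V → ℕ, ∀ v ≠ r, ∃ e, p e ∧
      ((fst e = v ∧ lev (snd e) < lev v) ∨ (snd e = v ∧ lev (fst e) < lev v)) := by
  classical
  set P : Finset V → Prop := fun S => r ∈ S ∧ ∃ lev : V → ℕ, ∀ v ∈ S, v ≠ r → ∃ e, p e ∧
      ((fst e = v ∧ snd e ∈ S ∧ lev (snd e) < lev v) ∨
        (snd e = v ∧ fst e ∈ S ∧ lev (fst e) < lev v)) with hP
  have hr : P {r} := ⟨by simp, fun _ => 0, by simp⟩
  obtain ⟨S, hS, hmax⟩ := Finset.exists_max_image (Finset.univ.filter P) Finset.card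
    ⟨{r}, by simpa using hr⟩
  obtain ⟨hrS, lev, hlev⟩ := (Finset.mem_filter.1 hS).2
  by_cases huniv : S = Finset.univ
  · subst huniv
    exact ⟨lev, fun v hv => by simpa using hlev v (Finset.mem_univ v) hv⟩
  exfalso
  have key : ∀ x y, x ∈ S → y ∉ S →
      (∃ e, p e ∧ ((fst e = y ∧ snd e = x) ∨ (snd e = y ∧ fst e = x))) → False := by
    rintro x y hx hy ⟨e, he, hxy⟩
    have hne : ∀ v ∈ S, v ≠ y := by rintro v hv rfl; exact hy hv
    have hPy : P (insert y S) := by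
      refine ⟨Finset.mem_insert_of_mem hrS, Function.update lev y (lev x + 1), fun v hv hvr => ?_⟩
      obtain rfl | hv := Finset.mem_insert.1 hv
      · refine ⟨e, he, ?_⟩
        obtain ⟨h1, h2⟩ | ⟨h1, h2⟩ := hxy
        · exact Or.inl ⟨h1, by rw [h2]; exact Finset.mem_insert_of_mem hx,
            by simp [h2, hne x hx]⟩
        · exact Or.inr ⟨h1, by rw [h2]; exact Finset.mem_insert_of_mem hx,
            by simp [h2, hne x hx]⟩
      · obtain ⟨e, he, ⟨h1, h2, h3⟩ | ⟨h1, h2, h3⟩⟩ := hlev v hv hvr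
        · exact ⟨e, he, Or.inl ⟨h1, Finset.mem_insert_of_mem h2, by
            simpa [hne v hv, hne _ h2] using h3⟩⟩
        · exact ⟨e, he, Or.inr ⟨h1, Finset.mem_insert_of_mem h2, by
            simpa [hne v hv, hne _ h2] using h3⟩⟩
    have := hmax _ (Finset.mem_filter.2 ⟨Finset.mem_univ _, hPy⟩)
    rw [Finset.card_insert_of_notMem hy] at this
    omega
  obtain ⟨e, he, hcross⟩ := h S ⟨r, hrS⟩ huniv
  by_cases h1 : fst e ∈ S
  · exact key (fst e) (snd e) h1 (fun h2 => hcross ⟨fun _ => h2, fun _ => h1⟩)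
      ⟨e, he, Or.inr ⟨rfl, rfl⟩⟩
  · exact key (snd e) (fst e) (by tauto) h1 ⟨e, he, Or.inl ⟨rfl, rfl⟩⟩

theorem exists_int_mem_pair_of_parity (n : ℤ) (c : ZMod 2) :
    ∃ m : ℤ, n ≤ m ∧ m ≤ n + 1 ∧ (m : ZMod 2) = c := by
  by_cases h : (n : ZMod 2) = c
  · exact ⟨n, le_rfl, by omega, h⟩
  · refine ⟨n + 1, by omega, le_rfl, ?_⟩
    push_cast
    generalize (n : ZMod 2) = x at h
    revert x c
    decide

variable [Fintype E] [DecidableEq E]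

/-- The main theorem for a multigraph whose edges are given together with their ends. -/
theorem exists_connected_parity_edges (fst snd : E → V) (r : V)
    (hcut : ∀ S : Finset V, S.Nonempty → S ≠ Finset.univ →
      4 ≤ (Finset.univ.filter fun e => ¬ (fst e ∈ S ↔ snd e ∈ S)).card)
    (f : V → ZMod 2) (hf : ∑ v, f v = 0) :
    ∃ F : Finset E,
      (∀ S : Finset V, S.Nonempty → S ≠ Finset.univ → ∃ e ∈ F, ¬ (fst e ∈ S ↔ snd e ∈ S)) ∧
      ∀ v, (endDegree fst snd F v : ZMod 2) = f v ∧
        endDegree fst snd Finset.univ v / 2 ≤ endDegree fst snd F v + 1 ∧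
        endDegree fst snd F v ≤ (endDegree fst snd Finset.univ v + 1) / 2 + 2 := by
  obtain ⟨g, hg0, hg1, hg⟩ := exists_two_connected_and_orientation fst snd r hcut
  obtain ⟨lev, hlev⟩ := exists_level_of_crossing fst snd r _ hg1
  set d := endDegree fst snd Finset.univ with hd
  set D : Finset E := Finset.univ.filter fun e => g e ≠ 0 with hD
  have hmemD : ∀ e, e ∈ D ↔ g e ≠ 0 := by simp [hD]
  -- Edges of the second connected subgraph point towards the higher level; ties may go either way.
  set toSnd : E → Prop := fun e => g e = 3 ∨ (g e = 1 ∧ lev (fst e) < lev (snd e)) with htoSnd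
  have : DecidablePred toSnd := fun _ => Classical.propDecidable _
  set head : E → V := fun e => if toSnd e then snd e else fst e with hhead
  set tail : E → V := fun e => if toSnd e then fst e else snd e with htail
  have hht : ∀ (e : E) (v : V) (c : ℕ), ((if head e = v then c else 0) + if tail e = v then c else 0) =
      (if fst e = v then c else 0) + if snd e = v then c else 0 := by
    intro e v c
    simp only [hhead, htail]
    by_cases h : toSnd e <;> simp only [h, if_true, if_false]
    exact add_comm _ _
  have hdegD : ∀ v, (D.filter fun e => head e = v).card + (D.filter fun e => tail e = v).card =
      endDegree fst snd D v := by
    intro v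
    simp only [endDegree, Finset.card_filter, ← Finset.sum_add_distrib, hht]
  have hlevhead : ∀ v ≠ r, ∃ e ∈ D, g e = 1 ∧ head e = v ∧ lev (tail e) < lev v := by
    intro v hv
    obtain ⟨e, he, ⟨h1, h2⟩ | ⟨h1, h2⟩⟩ := hlev v hv
    · have h3 : ¬ toSnd e := by
        simp only [htoSnd, he, true_and, h1]
        rintro (h | h)
        · exact absurd h (by decide)
        · omega
      refine ⟨e, (hmemD e).2 (by rw [he]; decide), he, ?_, ?_⟩ <;>
        simp only [hhead, htail, h3, if_false, h1, h2]
    · have h3 : toSnd e := Or.inr ⟨he, h1 ▸ h2⟩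
      refine ⟨e, (hmemD e).2 (by rw [he]; decide), he, ?_, ?_⟩ <;>
        simp only [hhead, htail, h3, if_true, h1, h2]
  have hin : ∀ v, d v / 2 ≤ (D.filter fun e => head e = v).card + 1 := by
    intro v
    have h1 := hg v
    have h2 : (Finset.univ.filter fun e => (g e = 2 ∧ fst e = v) ∨ (g e = 3 ∧ snd e = v)) ⊆
        D.filter fun e => head e = v := by
      intro e he
      simp only [Finset.mem_filter, Finset.mem_univ, true_and, hmemD] at he ⊢
      obtain ⟨h3, h4⟩ | ⟨h3, h4⟩ := he
      · have : ¬ toSnd e := by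
          rintro (h | ⟨h, -⟩) <;> rw [h3] at h <;> exact absurd h (by decide)
        refine ⟨by rw [h3]; decide, ?_⟩
        simp only [hhead, this, if_false, h4]
      · have : toSnd e := Or.inl h3
        refine ⟨by rw [h3]; decide, ?_⟩
        simp only [hhead, this, if_true, h4]
    by_cases hvr : v = r
    · rw [if_pos hvr] at h1
      exact h1.trans (Nat.add_le_add_right (Finset.card_le_card h2) 1)
    · rw [if_neg hvr] at h1
      obtain ⟨e, he, he1, hev, -⟩ := hlevhead v hvr
      have h3 := Finset.card_lt_card (Finset.ssubset_iff_subset_ne.2 ⟨h2, fun h => by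
        have h4 := h.symm ▸ (Finset.mem_filter.2 ⟨he, hev⟩ : e ∈ D.filter fun e => head e = v)
        simp only [Finset.mem_filter, he1] at h4
        obtain ⟨h5, -⟩ | ⟨h5, -⟩ := h4.2 <;> exact absurd h5 (by decide)⟩)
      omega
  have hcompl : ∀ v, endDegree fst snd Dᶜ v + endDegree fst snd D v = d v := by
    intro v
    rw [add_comm]
    exact endDegree_add_compl fst snd D v
  have hpos : ∀ v ≠ r, 1 ≤ endDegree fst snd Dᶜ v := by
    intro v hv
    obtain ⟨e, he, hcross⟩ := hg0 {v} (by simp) fun h => hv <| by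
      have := h ▸ Finset.mem_univ r
      exact (Finset.mem_singleton.1 this).symm
    have heD : e ∈ Dᶜ := by rw [Finset.mem_compl, hmemD]; simpa using he
    have := card_crossing_le_sum_endDegree fst snd Dᶜ {v}
    rw [Finset.sum_singleton] at this
    exact le_trans (Finset.card_pos.2 ⟨e, Finset.mem_filter.2 ⟨heD, hcross⟩⟩) this
  -- Each bound is rounded up to the parity of `f v`. This places `l v` at most at `d v / 2` and `u
  -- v` at least at `(d v + 1) / 2 + 1`, as the in-degree and out-degree conditions require.
  choose l hl1 hl2 hl3 using fun v => exists_int_mem_pair_of_parity ((d v / 2 : ℕ) - 1 : ℤ) (f v)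
  choose u hu1 hu2 hu3 using fun v =>
    exists_int_mem_pair_of_parity (((d v + 1) / 2 : ℕ) + 1 : ℤ) (f v)
  -- `none` is both the auxiliary outer vertex and the auxiliary arc from it to `r`. Vertex sets
  -- containing `r` are entered by this arc; any other is entered at a vertex of least level.
  set hd' : Option E → Option V := fun o => o.elim (some r) fun e => some (head e) with hhd'
  set tl' : Option E → Option V := fun o => o.map tail with htl'
  set d₀ := endDegree fst snd Dᶜ with hd₀
  obtain ⟨z, hz⟩ := exists_signedDegree_mem_Icc (fun _ => false) (Finset.insertNone D)
    (Finset.univ.erase (none : Option V)) hd' tl'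
    (fun a _ => by cases a <;> simp [hhd'])
    (fun S hS hne => by
      by_cases hr : some r ∈ S
      · refine ⟨none, by simp, by simpa [hhd'] using hr, fun h => ?_⟩
        have := hS h
        simp [htl'] at this
      · obtain ⟨x, hx, hmin⟩ := Finset.exists_min_image S (fun o => o.elim 0 lev) hne
        obtain _ | v := x
        · have := hS hx
          simp at this
        · obtain ⟨e, he, -, h1, h2⟩ := hlevhead v (by rintro rfl; exact hr hx)
          refine ⟨some e, by simpa using he, by simpa [hhd', h1] using hx, fun h => ?_⟩
          have := hmin _ h
          simp only [htl', Option.map_some, Option.elim_some] at this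
          omega)
    (fun o => o.elim 0 fun v => l v - d₀ v) (fun o => o.elim 0 fun v => u v - d₀ v)
    (fun o ho => by
      obtain _ | v := o
      · simp at ho
      · simp only [Option.elim_some]
        have h1 := hl2 v
        have h2 := hu1 v
        refine ⟨by omega, ?_⟩
        rw [sub_sub_sub_cancel_right, ← ZMod.intCast_eq_zero_iff_even, Int.cast_sub, hl3, hu3,
          sub_self])
    -- The in-degree in `D` may fall one short of `d v / 2`. The missing unit comes from the
    -- auxiliary arc at `r`, and elsewhere from an edge of the first connected subgraph.
    (fun o ho => by
      obtain _ | v := o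
      · simp at ho
      · rw [Finset.card_filter, Finset.sum_insertNone]
        simp only [hhd', Option.elim_some, Option.elim_none, Option.some.injEq, ← Finset.card_filter]
        have h1 := hin v
        have h2 := hl2 v
        push_cast
        split_ifs with h
        · omega
        · have := hpos v (Ne.symm h)
          omega)
    (fun o ho => by
      obtain _ | v := o
      · simp at ho
      · rw [Finset.card_filter, Finset.sum_insertNone]
        simp only [htl', Option.map_some, Option.map_none, Option.elim_some, Option.some.injEq,
          ← Finset.card_filter, reduceCtorEq, if_false, zero_add]
        have h1 := hin v
        have h2 := hu1 v
        have h3 := hdegD v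
        have h4 := hcompl v
        omega)
  set Z : Finset E := D.filter fun e => z (some e) = true with hZ
  have hsd : ∀ v, signedDegree (Finset.insertNone D) hd' tl' (fun _ => false) z (some v) =
      (if r = v then (z none).toNat else 0) + endDegree fst snd Z v := by
    intro v
    rw [signedDegree, Finset.sum_insertNone]
    simp only [hhd', htl', Option.map_some, Option.map_none, Option.elim_some, Option.elim_none,
      Option.some.injEq, reduceCtorEq, if_false, add_zero, Bool.xor_false, hht]
    congr 1
    rw [endDegree, Finset.card_filter, Finset.card_filter, ← Finset.sum_add_distrib, hZ,
      Finset.sum_filter _ (s := D)]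
    refine Finset.sum_congr rfl fun e _ => ?_
    cases z (some e) <;> simp
  have hdisj : Disjoint Dᶜ Z :=
    (disjoint_compl_left (a := D)).mono_right (Finset.filter_subset _ _)
  have hF : ∀ v, endDegree fst snd (Dᶜ ∪ Z) v = d₀ v + endDegree fst snd Z v := by
    intro v
    simp only [hd₀, endDegree, Finset.filter_union]
    rw [Finset.card_union_of_disjoint (Finset.disjoint_filter_filter hdisj),
      Finset.card_union_of_disjoint (Finset.disjoint_filter_filter hdisj)]
    omega
  have hz' : ∀ v, l v ≤ (if r = v then (z none).toNat else 0) + endDegree fst snd (Dᶜ ∪ Z) v ∧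
      (if r = v then (z none).toNat else 0) + endDegree fst snd (Dᶜ ∪ Z) v ≤ u v ∧
      ((if r = v then (z none).toNat else 0 : ℕ) + endDegree fst snd (Dᶜ ∪ Z) v : ZMod 2) = f v := by
    intro v
    obtain ⟨h1, h2, h3⟩ := hz (some v) (by simp)
    rw [hsd] at h1 h2 h3
    rw [hF]
    simp only [Option.elim_some] at h1 h2 h3
    refine ⟨by push_cast at h1 ⊢; omega, by push_cast at h2 ⊢; omega, ?_⟩
    rw [← ZMod.intCast_eq_zero_iff_even] at h3
    push_cast at h3 ⊢
    rw [hl3] at h3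
    linear_combination h3
  -- Summing the congruences over all vertices leaves only the auxiliary arc, since both the degree
  -- sum and the sum of `f` vanish modulo 2.
  have hnone : (z none).toNat = 0 := by
    have h1 : ((z none).toNat : ZMod 2) = 0 := by
      rw [← hf, ← Finset.sum_congr rfl fun v _ => (hz' v).2.2, Finset.sum_add_distrib,
        ← Nat.cast_sum, ← Nat.cast_sum, sum_endDegree_univ, Finset.sum_ite_eq]
      simp only [Finset.mem_univ, if_true, Nat.cast_mul]
      have : ((2 : ℕ) : ZMod 2) = 0 := rfl
      rw [this, zero_mul, add_zero]
    revert h1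
    cases z none <;> simp
  refine ⟨Dᶜ ∪ Z, fun S h1 h2 => ?_, fun v => ?_⟩
  · obtain ⟨e, he, h⟩ := hg0 S h1 h2
    refine ⟨e, Finset.mem_union_left _ ?_, h⟩
    rw [Finset.mem_compl, hmemD]
    simpa using he
  · obtain ⟨h1, h2, h3⟩ := hz' v
    rw [hnone] at h1 h2 h3
    simp only [ite_self, Nat.cast_zero, zero_add] at h1 h2 h3
    have := hl1 v
    have := hu2 v
    exact ⟨h3, by omega, by omega⟩

end parity

/-! ### Transfer to `Graph` -/

namespace Graph

section restrict

variable {α β : Type*} {G : Graph α β} {fst snd : G.edgeSet → G.vertexSet}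

theorem degree_restrict_eq_endDegree [DecidableEq G.vertexSet] [DecidableEq G.edgeSet]
    (hlink : ∀ e : G.edgeSet, G.IsLink e (fst e) (snd e)) (F : Finset G.edgeSet)
    (v : G.vertexSet) :
    (G.restrict (Subtype.val '' (F : Set G.edgeSet))).degree v = endDegree fst snd F v := by
  have h1 : (G.restrict (Subtype.val '' (F : Set G.edgeSet))).incidenceSet v =
      Subtype.val '' ((F.filter fun e => fst e = v ∨ snd e = v : Finset G.edgeSet) :
        Set G.edgeSet) := by
    ext e
    simp only [mem_incidenceSet, restrict_inc, Set.mem_image, Finset.mem_coe, Finset.mem_filter]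
    constructor
    · rintro ⟨h, e, he, rfl⟩
      refine ⟨e, ⟨he, ?_⟩, rfl⟩
      exact (h.eq_or_eq_of_isLink (hlink e)).imp (fun h => Subtype.ext h.symm)
        fun h => Subtype.ext h.symm
    · rintro ⟨e, ⟨he, rfl | rfl⟩, rfl⟩
      · exact ⟨(hlink e).inc_left, e, he, rfl⟩
      · exact ⟨(hlink e).inc_right, e, he, rfl⟩
  have h2 : (G.restrict (Subtype.val '' (F : Set G.edgeSet))).loopSet v =
      Subtype.val '' ((F.filter fun e => fst e = v ∧ snd e = v : Finset G.edgeSet) :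
        Set G.edgeSet) := by
    ext e
    simp only [mem_loopSet, restrict_isLoopAt, Set.mem_image, Finset.mem_coe, Finset.mem_filter]
    constructor
    · rintro ⟨h, e, he, rfl⟩
      exact ⟨e, ⟨he, Subtype.ext (h.eq_of_inc (hlink e).inc_left).symm,
        Subtype.ext (h.eq_of_inc (hlink e).inc_right).symm⟩, rfl⟩
    · rintro ⟨e, ⟨he, h3, h4⟩, rfl⟩
      have := hlink e
      rw [h3, h4] at this
      exact ⟨this, e, he, rfl⟩
  rw [degree, h1, h2, Set.ncard_image_of_injective _ Subtype.val_injective,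
    Set.ncard_image_of_injective _ Subtype.val_injective, Set.ncard_coe_finset,
    Set.ncard_coe_finset, Finset.filter_or, Finset.filter_and, Finset.card_union_add_card_inter,
    endDegree]

theorem connected_restrict_of_crossing [Nonempty G.vertexSet] [Fintype G.vertexSet]
    (hlink : ∀ e : G.edgeSet, G.IsLink e (fst e) (snd e)) (F : Set G.edgeSet)
    (hF : ∀ S : Finset G.vertexSet, S.Nonempty → S ≠ Finset.univ →
      ∃ e ∈ F, ¬ (fst e ∈ S ↔ snd e ∈ S)) :
    (G.restrict (Subtype.val '' F)).Connected := by
  classical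
  refine ⟨Set.nonempty_coe_sort.1 ‹Nonempty G.vertexSet›, fun x hx y hy => ?_⟩
  set S : Finset G.vertexSet := Finset.univ.filter fun v =>
    Relation.ReflTransGen (G.restrict (Subtype.val '' F)).Adj x v with hS
  have hmem : ∀ v, v ∈ S ↔ Relation.ReflTransGen (G.restrict (Subtype.val '' F)).Adj x v := by
    simp [hS]
  by_cases huniv : S = Finset.univ
  · exact (hmem ⟨y, hy⟩).1 (huniv ▸ Finset.mem_univ _)
  obtain ⟨e, he, hcross⟩ := hF S ⟨⟨x, hx⟩, (hmem _).2 .refl⟩ huniv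
  have hadj : (G.restrict (Subtype.val '' F)).Adj (fst e) (snd e) := ⟨e, ⟨e, he, rfl⟩, hlink e⟩
  exact absurd ⟨fun h => (hmem _).2 (((hmem _).1 h).tail hadj),
    fun h => (hmem _).2 (((hmem _).1 h).tail hadj.symm)⟩ hcross

theorem IsEdgeConnected.le_card_crossing [Fintype G.edgeSet] [DecidableEq G.vertexSet] {n : ℕ}
    (hG : G.IsEdgeConnected n) (hlink : ∀ e : G.edgeSet, G.IsLink e (fst e) (snd e))
    (S : Finset G.vertexSet) (hne : S.Nonempty) (hS : ∃ v, v ∉ S) :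
    n ≤ (Finset.univ.filter fun e => ¬ (fst e ∈ S ↔ snd e ∈ S)).card := by
  obtain ⟨v, hv⟩ := hS
  have hval : ∀ x : G.vertexSet, (x : α) ∈ Subtype.val '' (S : Set G.vertexSet) ↔ x ∈ S := by
    intro x
    simp
  have h1 := hG.2 (Subtype.val '' (S : Set G.vertexSet)) ⟨by rintro _ ⟨x, -, rfl⟩; exact x.2,
    fun h => hv ((hval v).1 (h v.2))⟩ (hne.to_set.image _)
  have h2 : G.edgeCut (Subtype.val '' (S : Set G.vertexSet)) ⊆ Subtype.val ''
      ((Finset.univ.filter fun e => ¬ (fst e ∈ S ↔ snd e ∈ S) : Finset G.edgeSet) :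
        Set G.edgeSet) := by
    rintro e ⟨x, y, he, hx, hy⟩
    refine ⟨⟨e, he.edge_mem⟩, ?_, rfl⟩
    have h3 := he.eq_and_eq_or_eq_and_eq (hlink ⟨e, he.edge_mem⟩)
    simp only [Finset.coe_filter, Finset.mem_univ, true_and, Set.mem_ofPred_eq, ← hval]
    obtain ⟨rx, ry⟩ | ⟨rx, ry⟩ := h3 <;> rw [rx] at hx <;> rw [ry] at hy <;> tauto
  have h4 := h1.trans (Set.encard_le_encard h2)
  rw [Set.InjOn.encard_image Subtype.val_injective.injOn, Set.encard_coe_eq_coe_finsetCard] at h4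
  exact_mod_cast h4

end restrict

theorem IsEdgeConnected.exists_connected_modFactor {α β : Type*} {G : Graph α β}
    (hV : G.vertexSet.Finite) (hE : G.edgeSet.Finite) (hG : G.IsEdgeConnected 4)
    (f : α → ZMod 2) (hf : ∑ v ∈ hV.toFinset, f v = 0) :
    ∃ H : Graph α β, G.IsModFactor f H ∧ H.Connected ∧
      ∀ v ∈ G.vertexSet,
        ⌊(G.degree v : ℚ) / 2⌋ - 1 ≤ (H.degree v : ℤ) ∧
        (H.degree v : ℤ) ≤ ⌈(G.degree v : ℚ) / 2⌉ + 2 := by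
  classical
  have := hV.fintype
  have := hE.fintype
  obtain ⟨r, hr⟩ := hG.1
  have : Nonempty G.vertexSet := ⟨⟨r, hr⟩⟩
  have hends : ∀ e : G.edgeSet, ∃ p : G.vertexSet × G.vertexSet, G.IsLink e p.1 p.2 := by
    intro e
    obtain ⟨x, y, h⟩ := G.exists_isLink_of_mem_edgeSet e.2
    exact ⟨(⟨x, h.left_mem⟩, ⟨y, h.right_mem⟩), h⟩
  choose p hp using hends
  obtain ⟨F, hF, hdeg⟩ := exists_connected_parity_edges (fun e => (p e).1) (fun e => (p e).2)
    ⟨r, hr⟩ (fun S hne hS => hG.le_card_crossing hp S hne <| by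
      by_contra! h
      exact hS (Finset.eq_univ_iff_forall.2 h)) (fun v => f v) (by
      rw [← hf, ← Finset.sum_subtype hV.toFinset (fun x => by simp) f])
  have hGdeg : ∀ v : G.vertexSet, G.degree v =
      endDegree (fun e => (p e).1) (fun e => (p e).2) Finset.univ v := by
    intro v
    rw [← degree_restrict_eq_endDegree hp, restrict_eq_self_iff _ _ |>.2]
    simp
  refine ⟨G.restrict (Subtype.val '' (F : Set G.edgeSet)), ⟨⟨restrict_le, rfl⟩, fun v hv => ?_⟩,
    connected_restrict_of_crossing hp _ hF, fun v hv => ?_⟩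
  · exact (congrArg Nat.cast (degree_restrict_eq_endDegree hp F ⟨v, hv⟩)).trans (hdeg ⟨v, hv⟩).1
  · have h1 := degree_restrict_eq_endDegree hp F ⟨v, hv⟩
    have h2 := hGdeg ⟨v, hv⟩
    obtain ⟨-, h3, h4⟩ := hdeg ⟨v, hv⟩
    rw [← h1, ← h2] at h3 h4
    have h5 := Int.floor_le ((G.degree v : ℚ) / 2)
    have h6 := Int.le_ceil ((G.degree v : ℚ) / 2)
    rw [le_div_iff₀ two_pos] at h5
    rw [div_le_iff₀ two_pos] at h6
    -- One-sided inequalities suffice: an integer at most half the degree is at most the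
    -- natural-number quotient, and dually for the ceiling.
    generalize ⌊(G.degree v : ℚ) / 2⌋ = a at h5 ⊢
    generalize ⌈(G.degree v : ℚ) / 2⌉ = b at h6 ⊢
    norm_cast at h5 h6
    dsimp only at h3 h4
    constructor <;> omega

end Graph

theorem mainTheorem6 {α β : Type*} (G : Graph α β)
    (hV : G.vertexSet.Finite) (hE : G.edgeSet.Finite) (hG : G.IsEdgeConnected 4) :
    (∀ f : α → ZMod 2, ∑ v ∈ hV.toFinset, f v = 0 →
      ∃ H : Graph α β, G.IsModFactor f H ∧ H.Connected ∧
        ∀ v ∈ G.vertexSet,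
          ⌊(G.degree v : ℚ) / 2⌋ - 1 ≤ (H.degree v : ℤ) ∧
          (H.degree v : ℤ) ≤ ⌈(G.degree v : ℚ) / 2⌉ + 2) ∧
    (∃ H : Graph α β, H ≤s G ∧ H.IsEulerian ∧
        ∀ v ∈ G.vertexSet,
          ⌊(G.degree v : ℚ) / 2⌋ - 1 ≤ (H.degree v : ℤ) ∧
          (H.degree v : ℤ) ≤ ⌈(G.degree v : ℚ) / 2⌉ + 2) := by
  refine ⟨fun f hf => hG.exists_connected_modFactor hV hE f hf, ?_⟩
  obtain ⟨H, ⟨hs, hdeg⟩, hH, hb⟩ := hG.exists_connected_modFactor hV hE (fun _ => 0) (by simp)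
  exact ⟨H, hs, ⟨hH, fun v hv => ZMod.natCast_eq_zero_iff_even.1
    (hdeg v (hs.vertexSet_eq ▸ hv))⟩, hb⟩
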